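/- Let $\Omega_1=\Omega_2=\{0,1\}^{\mathbb N}$ be two copies of the Cantor space; for a binary string $s$ let $[s]$ be the set of infinite sequences extending $s$. A probability measure $P$ on $\Omega_1\times\Omega_2$ is computable if the numbers $P([s]\times[t])$ are computable reals uniformly in the strings $s,t$. The conditional measure $P(\cdot\,|\,\alpha_1)$ is defined if $P([a]\times\Omega_2)>0$ for every prefix $a$ of $\alpha_1$ and there is a probability measure $P(\cdot\,|\,\alpha_1)$ on $\Omega_2$ with $$P([t]\,|\,\alpha_1)=\lim_{n\to\infty}\frac{P([a_n]\times[t])}{P([a_n]\times\Omega_2)}\quad\text{for every string }t,$$ where $a_n$ is the prefix of $\alpha_1$ of length $n$. A Martin-Löf test for a measure $\mu$ (with an oracle) is a sequence of sets $U_n$, effectively open uniformly in $n$ (with that oracle), with $\mu(U_n)\le 2^{-n}$. A point is $\mu$-random if it lies in $\bigcap_n U_n$ for no oracle-free Martin-Löf test for $\mu$ ($\mu$ computable). It is blind (Hippocratic) random relative to $\alpha_1$ for $\mu$, where $\mu$ need not be computable, if it lies in $\bigcap_n U_n$ for no Martin-Löf test for $\mu$ with oracle $\alpha_1$ (the tests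 have no access to $\mu$). A sequence is identified with the real in $[0,1]$ of which it is a binary expansion. By a Chaitin $\Omega$-number we mean a sequence that is Martin-Löf random for the uniform measure and whose real value is lower semicomputable, i.e. the limit of a computable nondecreasing sequence of binary fractions. **Theorem.** Chaitin $\Omega$-numbers exist, and for every Chaitin $\Omega$-number $\alpha_2\in\Omega_2$ there is a computable probability measure $P$ on $\Omega_1\times\Omega_2$ for which the conditional measure $P(\cdot\,|\,\alpha_1)$ is defined for all $\alpha_1\in\Omega_1$, and there is an $\alpha_1\in\Omega_1$ such that * the pair $(\alpha_1,\alpha_2)$ is $P$-random; * $P(\cdot\,|\,\alpha_1)$ is the uniform distribution on $[\alpha_2,1]$; * $\alpha_2$ is not blind random relative to $\alpha_1$ for $P(\cdot\,|\,\alpha_1)$. In particular there are a computable measure $P$ with $P(\cdot\,|\,\alpha_1)$ defined for all $\alpha_1$, and a $P$-random pair $(\alpha_1,\alpha_2)$, such that $\alpha_2$ is not blind random relative to $\alpha_1$ for $P(\cdot\,|\,\alpha_1)$. -/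

import Mathlib

open Set Filter Topology MeasureTheory

namespace CantorRandom

/-- The Cantor space of infinite binary sequences (with the product topology and its Borel
σ-algebra, which is the product σ-algebra). -/
abbrev Cantor : Type := ℕ → Bool

/-- The interval `[s]`: all infinite sequences that extend the finite string `s`. -/
def cyl (s : List Bool) : Set Cantor :=
  {x | ∀ i : Fin s.length, x i = s.get i}

/-- The rectangle `[s] × [t]` in the product of two Cantor spaces. -/
def rect (p : List Bool × List Bool) : Set (Cantor × Cantor) :=
  cyl p.1 ×ˢ cyl p.2

/-- The prefix of length `n` of an infinite sequence. -/
def pre (x : Cantor) (n : ℕ) : List Bool := (List.range n).map x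

/-- An infinite sequence used as an oracle: its characteristic function. -/
def oracle (x : Cantor) : ℕ →. ℕ := fun n => Part.some (x n).toNat

/-- The sets `U 0, U 1, …` are effectively open uniformly in `n`, with oracles `O`, with respect to
the indexed family `basic` of basic open sets: some partial function `f`, recursive in `O`, is such
that `U n` is the union of all basic sets `basic i` for which `f` halts on `(n, i)`. -/
def UniformlyEffectivelyOpenIn {ι X : Type} [Primcodable ι] (O : Set (ℕ →. ℕ))
    (basic : ι → Set X) (U : ℕ → Set X) : Prop :=
  ∃ f : ℕ × ι →. Unit, RecursiveIn O f ∧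
    ∀ n, U n = ⋃ i ∈ {i : ι | (f (n, i)).Dom}, basic i

/-- A Martin-Löf test with oracles `O` for the measure `μ`.  The oracles give no access to `μ`. -/
def IsMartinLofTestIn {ι X : Type} [Primcodable ι] [MeasurableSpace X] (O : Set (ℕ →. ℕ))
    (basic : ι → Set X) (μ : Measure X) (U : ℕ → Set X) : Prop :=
  UniformlyEffectivelyOpenIn O basic U ∧ ∀ n, μ (U n) ≤ 1 / 2 ^ n

/-- `x` passes all Martin-Löf tests with oracles `O` for `μ`.  When `μ` is computable (with the
oracles) this is Martin-Löf randomness (with the oracles); for an arbitrary `μ` this is blind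
(Hippocratic) randomness. -/
def PassesAllTestsIn {ι X : Type} [Primcodable ι] [MeasurableSpace X] (O : Set (ℕ →. ℕ))
    (basic : ι → Set X) (μ : Measure X) (x : X) : Prop :=
  ∀ U : ℕ → Set X, IsMartinLofTestIn O basic μ U → x ∉ ⋂ n, U n

/-- Martin-Löf randomness (without oracle) of a sequence; used for computable measures `μ`. -/
def MLRandom (μ : Measure Cantor) (x : Cantor) : Prop :=
  PassesAllTestsIn ∅ cyl μ x

/-- Martin-Löf randomness (without oracle) of a pair; used for computable measures `P`. -/
def MLRandomPair (P : Measure (Cantor × Cantor)) (z : Cantor × Cantor) : Prop :=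
  PassesAllTestsIn ∅ rect P z

/-- `x` is blind (Hippocratic) random with oracle `a` for the, possibly noncomputable, measure `μ`:
tests are enumerated with oracle `a` only. -/
def BlindRandomRel (a : Cantor) (μ : Measure Cantor) (x : Cantor) : Prop :=
  PassesAllTestsIn {oracle a} cyl μ x

/-- A measure on pairs is computable if the measures of the rectangles `[s] × [t]` are uniformly
computable reals: they can be approximated within `2⁻ᵏ` by a computable dyadic rational. -/
def ComputableMeasure (P : Measure (Cantor × Cantor)) : Prop :=
  ∃ q : (List Bool × List Bool) × ℕ → ℕ, Computable q ∧
    ∀ (p : List Bool × List Bool) (k : ℕ), |P.real (rect p) - (q (p, k) : ℝ) / 2 ^ k| ≤ 1 / 2 ^ k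

/-- The conditional measure `P(· | a)` is defined and equals `ν`: every prefix of `a` has positive
marginal probability, and for every string `t` the ratio `P([a₁] × [t]) / P([a₁] × Ω₂)` tends to
`ν [t]` as the length of the prefix `a₁` of `a` tends to infinity. -/
def IsConditionalMeasure (P : Measure (Cantor × Cantor)) (a : Cantor) (ν : Measure Cantor) :
    Prop :=
  IsProbabilityMeasure ν ∧
    (∀ n, P (cyl (pre a n) ×ˢ univ) ≠ 0) ∧
    ∀ t : List Bool,
      Tendsto (fun n => P (cyl (pre a n) ×ˢ cyl t) / P (cyl (pre a n) ×ˢ univ)) atTop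
        (𝓝 (ν (cyl t)))

/-- The uniform (fair coin) measure on the Cantor space. -/
noncomputable def fairCoin : Measure Cantor :=
  Measure.infinitePi fun _ : ℕ => (PMF.uniformOfFintype Bool).toMeasure

/-- The real number in `[0, 1]` with binary expansion `0.x₀x₁x₂…`. -/
noncomputable def value (x : Cantor) : ℝ :=
  ∑' n : ℕ, if x n then (1 / 2 : ℝ) ^ (n + 1) else 0

/-- The uniform distribution on `[r, 1]`, as a measure on binary expansions. -/
noncomputable def uniformAbove (r : ℝ) : Measure Cantor :=
  ProbabilityTheory.cond fairCoin {x | r ≤ value x}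

/-- The nonnegative real `r` is the limit of a computable nondecreasing sequence of binary
fractions. -/
def LowerSemicomputable (r : ℝ) : Prop :=
  ∃ p e : ℕ → ℕ, Computable p ∧ Computable e ∧
    Monotone (fun n => (p n : ℝ) / 2 ^ e n) ∧
    Tendsto (fun n => (p n : ℝ) / 2 ^ e n) atTop (𝓝 r)

/-- `w` is (the binary expansion of) a Chaitin Ω-number: a lower semicomputable real that is
Martin-Löf random with respect to the uniform measure. -/
def IsOmegaNumber (w : Cantor) : Prop :=
  LowerSemicomputable (value w) ∧ MLRandom fairCoin w

end CantorRandom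

open CantorRandom

/-!
Existence of `Ω`: from the sets enumerated by the program `e`, keep at level `e + 2` only what does
not push the measure above `1 / 2 ^ (e + 2)`. The union over all `e` has measure less than `1` and
contains every nonrandom sequence, so the least sequence outside it is random. Its value is the
limit of the nondecreasing sequence of the least values not yet covered at finite stages.

For the main construction, let `0 = a₀ < a₁ < …` be a computable sequence of dyadic rationals with
limit `α₂`. Choose `x` uniformly, and let `y` be `0ᵏ1` followed by independent random digits when
`aₖ ≤ x < aₖ₊₁`, and `000…` when `x` lies above all `aₖ`. The joint distribution of `(y, x)` is
computable, because a finite prefix of `y` only involves finitely many of the `aₖ`. Given `0ᵏ1…`,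
the number `x` is uniform on `[aₖ, aₖ₊₁)`; given `000…`, it is uniform on `[α₂, 1]`.

For `α₁ = 000…` the pair `(α₁, α₂)` is random: if an enumerated rectangle `[0ᵏ] × [t]` contains it,
then the part of `[t]` above `aₖ` consists of the second coordinates of points of the support whose
first coordinate begins with `0ᵏ`. So a test for the joint distribution that rejects `(α₁, α₂)`
yields a test for the uniform distribution that rejects `α₂`. But `α₂` is not blind random for the
uniform distribution on `[α₂, 1]`: the intervals `[0, aₖ + ε]` are enumerable, their union contains
`α₂`, and only its part `[α₂, α₂ + ε]` carries mass.
-/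

namespace CantorRandom

/-! ### Strings and cylinders -/

@[simp]
lemma length_pre (x : Cantor) (n : ℕ) : (pre x n).length = n := by
  simp [pre]

lemma pre_succ (x : Cantor) (n : ℕ) : pre x (n + 1) = pre x n ++ [x n] := by
  simp [pre, List.range_succ]

lemma take_pre (x : Cantor) {m n : ℕ} (h : m ≤ n) : (pre x n).take m = pre x m := by
  simp [pre, ← List.map_take, List.take_range, h]

lemma pre_getD (t : List Bool) : pre (fun i => t.getD i false) t.length = t :=
  List.ext_getElem (by simp) fun i _ hi => by simp [pre, hi]

lemma pre_eq_pre_iff {x y : Cantor} {n : ℕ} : pre x n = pre y n ↔ ∀ i < n, x i = y i := by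
  simp [pre]

lemma mem_cyl_iff {x : Cantor} {t : List Bool} : x ∈ cyl t ↔ pre x t.length = t := by
  conv_rhs => rw [← pre_getD t, length_pre, pre_eq_pre_iff]
  exact ⟨fun h i hi => by simpa [hi] using h ⟨i, hi⟩, fun h i => by simpa using h i i.2⟩

lemma mem_cyl_pre {x y : Cantor} {n : ℕ} : y ∈ cyl (pre x n) ↔ ∀ i < n, y i = x i := by
  rw [mem_cyl_iff, length_pre, pre_eq_pre_iff]

lemma self_mem_cyl_pre (x : Cantor) (n : ℕ) : x ∈ cyl (pre x n) :=
  mem_cyl_pre.2 fun _ _ => rfl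

@[simp]
lemma cyl_nil : cyl [] = univ := by
  ext x
  simp [mem_cyl_iff, pre]

lemma cyl_pre_eq_cylinder (x : Cantor) (n : ℕ) : cyl (pre x n) = PiNat.cylinder x n := by
  ext y
  rw [mem_cyl_pre, PiNat.mem_cylinder_iff]

lemma cyl_eq_cylinder (t : List Bool) :
    cyl t = PiNat.cylinder (fun i => t.getD i false) t.length := by
  rw [← cyl_pre_eq_cylinder, pre_getD]

lemma isOpen_cyl (t : List Bool) : IsOpen (cyl t) := by
  rw [cyl_eq_cylinder]
  exact PiNat.isOpen_cylinder _ _ _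

lemma measurableSet_cyl (t : List Bool) : MeasurableSet (cyl t) :=
  (isOpen_cyl t).measurableSet

lemma isTopologicalBasis_cyl : TopologicalSpace.IsTopologicalBasis (range cyl) := by
  convert PiNat.isTopologicalBasis_cylinders fun _ : ℕ => Bool using 1
  ext S
  constructor
  · rintro ⟨t, rfl⟩
    exact ⟨_, _, cyl_eq_cylinder t⟩
  · rintro ⟨x, n, rfl⟩
    exact ⟨pre x n, cyl_pre_eq_cylinder x n⟩

lemma isPiSystem_cyl : IsPiSystem (range cyl) := by
  rintro _ ⟨s, rfl⟩ _ ⟨t, rfl⟩ ⟨x, hs, ht⟩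
  rw [mem_cyl_iff] at hs ht
  rw [← hs, ← ht, cyl_pre_eq_cylinder, cyl_pre_eq_cylinder]
  rcases le_total s.length t.length with h | h
  · rw [inter_eq_right.2 (PiNat.cylinder_anti x h), ← cyl_pre_eq_cylinder]
    exact mem_range_self _
  · rw [inter_eq_left.2 (PiNat.cylinder_anti x h), ← cyl_pre_eq_cylinder]
    exact mem_range_self _

lemma ext_of_cyl {μ ν : Measure Cantor} [IsFiniteMeasure μ] (h : ∀ t, μ (cyl t) = ν (cyl t)) :
    μ = ν := by
  have hgen := isTopologicalBasis_cyl.borel_eq_generateFrom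
  rw [← BorelSpace.measurable_eq] at hgen
  exact ext_of_generate_finite _ hgen isPiSystem_cyl (by rintro _ ⟨t, rfl⟩; exact h t)
    (by simpa using h [])

lemma isClopen_setOf_pre (q : List Bool → Prop) (s : ℕ) : IsClopen {x | q (pre x s)} := by
  have isOpen (q : List Bool → Prop) : IsOpen {x | q (pre x s)} := by
    have h : {x | q (pre x s)} = ⋃ t ∈ {t : List Bool | q t ∧ t.length = s}, cyl t := by
      ext x
      simp only [mem_ofPred_eq, mem_iUnion₂, mem_cyl_iff, exists_prop]
      exact ⟨fun h => ⟨pre x s, ⟨h, length_pre x s⟩, by rw [length_pre]⟩,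
        fun ⟨t, ⟨hq, hs⟩, ht⟩ => by rwa [← hs, ht]⟩
    rw [h]
    exact isOpen_biUnion fun t _ => isOpen_cyl t
  exact ⟨⟨isOpen fun t => ¬ q t⟩, isOpen q⟩

/-! ### Binary expansions -/

/-- The natural number with binary expansion `t`, most significant digit first. -/
def natValue (t : List Bool) : ℕ :=
  t.foldl (fun n b => 2 * n + b.toNat) 0

@[simp]
lemma natValue_nil : natValue [] = 0 := rfl

lemma natValue_concat (t : List Bool) (b : Bool) :
    natValue (t ++ [b]) = 2 * natValue t + b.toNat := by
  simp [natValue]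

lemma natValue_lt (t : List Bool) : natValue t < 2 ^ t.length := by
  induction t using List.reverseRecOn with
  | nil => simp
  | append_singleton t b ih =>
    rw [natValue_concat, List.length_append, List.length_singleton, pow_succ]
    have := b.toNat_le
    lia

lemma pre_eq_of_natValue_eq (n : ℕ) {x y : Cantor} (h : natValue (pre x n) = natValue (pre y n)) :
    pre x n = pre y n := by
  induction n with
  | zero => rfl
  | succ n ih =>
    rw [pre_succ, pre_succ, natValue_concat, natValue_concat] at h
    have hx := (x n).toNat_le
    have hy := (y n).toNat_le
    have hbit : x n = y n := by
      rw [Bool.eq_iff_iff, ← Bool.toNat_eq_one, ← Bool.toNat_eq_one]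
      lia
    rw [pre_succ, pre_succ, ih (by lia), hbit]

/-- The least real with a binary expansion that starts with `t`. -/
noncomputable def leftEnd (t : List Bool) : ℝ :=
  natValue t / 2 ^ t.length

/-- The greatest real with a binary expansion that starts with `t`. -/
noncomputable def rightEnd (t : List Bool) : ℝ :=
  (natValue t + 1) / 2 ^ t.length

lemma rightEnd_eq (t : List Bool) : rightEnd t = leftEnd t + 1 / 2 ^ t.length :=
  add_div _ _ _

lemma leftEnd_nonneg (t : List Bool) : 0 ≤ leftEnd t := by
  unfold leftEnd
  positivity

lemma leftEnd_lt_rightEnd (t : List Bool) : leftEnd t < rightEnd t := by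
  rw [rightEnd_eq, lt_add_iff_pos_right]
  positivity

lemma rightEnd_le_one (t : List Bool) : rightEnd t ≤ 1 := by
  rw [rightEnd, div_le_one (by positivity)]
  exact_mod_cast natValue_lt t

@[simp]
lemma leftEnd_nil : leftEnd [] = 0 := by
  simp [leftEnd]

@[simp]
lemma rightEnd_nil : rightEnd [] = 1 := by
  simp [rightEnd]

/-- The digits of a binary sequence, in the form in which `Real.ofDigits` takes them. -/
def binaryDigits (x : Cantor) (n : ℕ) : Fin 2 :=
  finTwoEquiv.symm (x n)

lemma ofDigitsTerm_binaryDigits (x : Cantor) (n : ℕ) :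
    Real.ofDigitsTerm (binaryDigits x) n = if x n then (1 / 2 : ℝ) ^ (n + 1) else 0 := by
  cases h : x n <;> simp [Real.ofDigitsTerm, binaryDigits, finTwoEquiv, h]

lemma value_eq_ofDigits (x : Cantor) : value x = Real.ofDigits (binaryDigits x) :=
  tsum_congr fun n => (ofDigitsTerm_binaryDigits x n).symm

lemma continuous_value : Continuous value := by
  rw [funext value_eq_ofDigits]
  exact Real.continuous_ofDigits.comp
    (continuous_pi fun n => continuous_of_discreteTopology.comp (continuous_apply n))

lemma measurable_value : Measurable value :=
  continuous_value.measurable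

lemma sum_ofDigitsTerm_binaryDigits (x : Cantor) (n : ℕ) :
    ∑ i ∈ Finset.range n, Real.ofDigitsTerm (binaryDigits x) i = leftEnd (pre x n) := by
  induction n with
  | zero => simp [pre]
  | succ n ih =>
    rw [Finset.sum_range_succ, ih, ofDigitsTerm_binaryDigits, leftEnd, leftEnd, pre_succ,
      natValue_concat]
    cases x n <;> simp [pow_succ] <;> field

lemma monotone_leftEnd_pre (x : Cantor) : Monotone fun n => leftEnd (pre x n) := by
  refine monotone_nat_of_le_succ fun n => ?_
  rw [← sum_ofDigitsTerm_binaryDigits, ← sum_ofDigitsTerm_binaryDigits, Finset.sum_range_succ]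
  exact le_add_of_nonneg_right Real.ofDigitsTerm_nonneg

lemma tendsto_one_div_two_pow : Tendsto (fun n : ℕ => (1 : ℝ) / 2 ^ n) atTop (𝓝 0) := by
  simpa only [one_div_pow] using
    tendsto_pow_atTop_nhds_zero_of_lt_one one_half_pos.le (one_half_lt_one (α := ℝ))

lemma tendsto_leftEnd_pre (x : Cantor) :
    Tendsto (fun n => leftEnd (pre x n)) atTop (𝓝 (value x)) := by
  simp only [← sum_ofDigitsTerm_binaryDigits, value_eq_ofDigits]
  exact Real.summable_ofDigitsTerm.hasSum.tendsto_sum_nat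

lemma value_mem_Icc {x : Cantor} {t : List Bool} (h : x ∈ cyl t) :
    value x ∈ Icc (leftEnd t) (rightEnd t) := by
  rw [value_eq_ofDigits, Real.ofDigits_eq_sum_add_ofDigits _ t.length,
    sum_ofDigitsTerm_binaryDigits, mem_cyl_iff.1 h, rightEnd_eq, one_div, Nat.cast_ofNat]
  have hpos : (0 : ℝ) < (2 ^ t.length)⁻¹ := by positivity
  exact ⟨le_add_of_nonneg_right (mul_nonneg hpos.le (Real.ofDigits_nonneg _)),
    add_le_add_right (mul_le_of_le_one_right hpos.le (Real.ofDigits_le_one _)) _⟩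

lemma value_nonneg (x : Cantor) : 0 ≤ value x := by
  rw [value_eq_ofDigits]
  exact Real.ofDigits_nonneg _

lemma value_le_one (x : Cantor) : value x ≤ 1 := by
  rw [value_eq_ofDigits]
  exact Real.ofDigits_le_one _

/-- The standard binary expansion of a real in `[0, 1)`, with infinitely many zeros. -/
noncomputable def bits (r : ℝ) : Cantor :=
  fun n => finTwoEquiv (Real.digits r 2 n)

lemma binaryDigits_bits (r : ℝ) : binaryDigits (bits r) = Real.digits r 2 :=
  funext fun _ => finTwoEquiv.symm_apply_apply _

lemma value_bits {r : ℝ} (h : r ∈ Ico 0 1) : value (bits r) = r := by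
  rw [value_eq_ofDigits, binaryDigits_bits, Real.ofDigits_digits one_lt_two h]

lemma natValue_pre_bits {r : ℝ} (h : r ∈ Ico 0 1) (n : ℕ) :
    natValue (pre (bits r) n) = ⌊2 ^ n * r⌋₊ := by
  have hsum := Real.ofDigits_digits_sum_eq (b := 2) h n
  rw [← binaryDigits_bits, sum_ofDigitsTerm_binaryDigits, leftEnd, length_pre, Nat.cast_ofNat,
    mul_div_cancel₀ _ (by positivity)] at hsum
  exact_mod_cast hsum

lemma bits_mem_cyl {r : ℝ} (h : r ∈ Ico 0 1) {t : List Bool} :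
    bits r ∈ cyl t ↔ r ∈ Ico (leftEnd t) (rightEnd t) := by
  have hpos : (0 : ℝ) < 2 ^ t.length := by positivity
  rw [mem_Ico, leftEnd, rightEnd, div_le_iff₀' hpos, lt_div_iff₀' hpos,
    ← Nat.floor_eq_iff (mul_nonneg hpos.le h.1), ← natValue_pre_bits h, mem_cyl_iff]
  refine ⟨congrArg natValue, fun hval => ?_⟩
  rw [← pre_getD t, length_pre] at hval ⊢
  exact pre_eq_of_natValue_eq _ hval

lemma measurable_bits : Measurable bits := by
  refine measurable_pi_iff.2 fun n => ?_
  have hfloor : Measurable fun r : ℝ => ⌊r * (2 : ℕ) ^ (n + 1)⌋₊ :=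
    Nat.measurable_floor.comp (measurable_id.mul_const _)
  exact (measurable_from_nat (f := fun m => finTwoEquiv (Fin.ofNat 2 m))).comp hfloor

/-- The string of length `s` whose binary value is `m`, for `m < 2 ^ s`. -/
def binaryString (s m : ℕ) : List Bool :=
  pre (fun i => m.testBit (s - 1 - i)) s

@[simp]
lemma length_binaryString (s m : ℕ) : (binaryString s m).length = s :=
  length_pre _ _

lemma binaryString_succ (s m : ℕ) :
    binaryString (s + 1) m = binaryString s (m / 2) ++ [m.testBit 0] := by
  rw [binaryString, pre_succ, binaryString, add_tsub_cancel_right, Nat.sub_self]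
  congr 1
  refine pre_eq_pre_iff.2 fun i hi => ?_
  rw [← Nat.testBit_succ, show (s - 1 - i).succ = s - i by lia]

lemma natValue_binaryString {s m : ℕ} (h : m < 2 ^ s) : natValue (binaryString s m) = m := by
  induction s generalizing m with
  | zero => exact (Nat.lt_one_iff.1 h).symm
  | succ s ih =>
    rw [binaryString_succ, natValue_concat, ih (by rw [pow_succ] at h; lia),
      Nat.toNat_testBit, pow_zero, Nat.div_one, Nat.div_add_mod]

@[simp]
lemma binaryString_natValue_pre (x : Cantor) (s : ℕ) :
    binaryString s (natValue (pre x s)) = pre x s :=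
  pre_eq_of_natValue_eq s (natValue_binaryString (by simpa using natValue_lt (pre x s)))

/-! ### The fair coin measure -/

lemma ofReal_one_div_two_pow (n : ℕ) : ENNReal.ofReal (1 / 2 ^ n) = 1 / 2 ^ n := by
  rw [ENNReal.ofReal_div_of_pos (by positivity), ENNReal.ofReal_pow zero_le_two]
  simp

instance : IsProbabilityMeasure fairCoin :=
  inferInstanceAs (IsProbabilityMeasure (Measure.infinitePi _))

lemma fairCoin_forall_mem_eq (s : Finset ℕ) (x : Cantor) :
    fairCoin {y | ∀ i ∈ s, y i = x i} = 1 / 2 ^ s.card := by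
  have hcoin (b : Bool) : (PMF.uniformOfFintype Bool).toMeasure {b} = 1 / 2 := by
    rw [PMF.toMeasure_apply_singleton _ _ (measurableSet_singleton b)]
    simp
  have h := Measure.infinitePi_pi (fun _ : ℕ => (PMF.uniformOfFintype Bool).toMeasure)
    (s := s) (t := fun i => {x i}) fun i _ => measurableSet_singleton _
  simp only [hcoin, Finset.prod_const, one_div, ENNReal.inv_pow.symm] at h
  rw [one_div, ← h]
  rfl

lemma fairCoin_cyl (t : List Bool) : fairCoin (cyl t) = 1 / 2 ^ t.length := by
  conv_lhs => rw [← pre_getD t]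
  rw [← Finset.card_range t.length, ← fairCoin_forall_mem_eq _ fun i => t.getD i false]
  congr 1
  ext y
  simp only [mem_cyl_pre, Finset.mem_range, mem_ofPred_eq, Finset.card_range]

lemma fairCoin_setOf_pre (q : List Bool → Prop) [DecidablePred q] (s : ℕ) :
    fairCoin {x | q (pre x s)} = Nat.count (fun m => q (binaryString s m)) (2 ^ s) / 2 ^ s := by
  have h : {x | q (pre x s)} =
      ⋃ m ∈ {m ∈ Finset.range (2 ^ s) | q (binaryString s m)}, cyl (binaryString s m) := by
    ext x
    simp only [mem_ofPred_eq, mem_iUnion₂, Finset.mem_filter, Finset.mem_range, mem_cyl_iff,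
      length_binaryString, exists_prop]
    constructor
    · intro hx
      exact ⟨natValue (pre x s), ⟨by simpa using natValue_lt (pre x s), by simpa⟩, by simp⟩
    · rintro ⟨m, ⟨-, hm⟩, hx⟩
      rwa [hx]
  rw [h, measure_biUnion_finset _ fun m _ => measurableSet_cyl _]
  · simp only [fairCoin_cyl, length_binaryString, Finset.sum_const, Nat.count_eq_card_filter_range,
      nsmul_eq_mul, mul_one_div]
  · intro m hm n hn hmn
    refine disjoint_left.2 fun x hx hx' => hmn ?_
    rw [mem_cyl_iff, length_binaryString] at hx hx'
    rw [← natValue_binaryString (Finset.mem_range.1 (Finset.mem_filter.1 hm).1), ← hx, hx',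
      natValue_binaryString (Finset.mem_range.1 (Finset.mem_filter.1 hn).1)]

lemma fairCoin_eq_map : fairCoin = (volume.restrict (Ico (0 : ℝ) 1)).map bits := by
  refine ext_of_cyl fun t => ?_
  have h : bits ⁻¹' cyl t ∩ Ico 0 1 = Ico (leftEnd t) (rightEnd t) := by
    ext r
    constructor
    · exact fun ⟨ht, hr⟩ => (bits_mem_cyl hr).1 ht
    · intro ht
      have hr := Ico_subset_Ico (leftEnd_nonneg t) (rightEnd_le_one t) ht
      exact ⟨(bits_mem_cyl hr).2 ht, hr⟩
  rw [Measure.map_apply measurable_bits (measurableSet_cyl t),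
    Measure.restrict_apply (measurable_bits (measurableSet_cyl t)), h, Real.volume_Ico,
    rightEnd_eq, add_sub_cancel_left, ofReal_one_div_two_pow, fairCoin_cyl]

section

variable {J : Set ℝ} (hJ : MeasurableSet J)
include hJ

lemma fairCoin_value_preimage_inter_cyl (t : List Bool) :
    fairCoin (value ⁻¹' J ∩ cyl t) = volume (J ∩ Ico (leftEnd t) (rightEnd t)) := by
  have hm := (measurable_value hJ).inter (measurableSet_cyl t)
  have h : bits ⁻¹' (value ⁻¹' J ∩ cyl t) ∩ Ico 0 1 = J ∩ Ico (leftEnd t) (rightEnd t) := by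
    ext r
    constructor
    · rintro ⟨⟨h1, h2⟩, h3⟩
      rw [mem_preimage, value_bits h3] at h1
      exact ⟨h1, (bits_mem_cyl h3).1 h2⟩
    · rintro ⟨h1, h2⟩
      have h3 := Ico_subset_Ico (leftEnd_nonneg t) (rightEnd_le_one t) h2
      refine ⟨⟨?_, (bits_mem_cyl h3).2 h2⟩, h3⟩
      rwa [mem_preimage, value_bits h3]
  rw [fairCoin_eq_map, Measure.map_apply measurable_bits hm,
    Measure.restrict_apply (measurable_bits hm), h]

lemma fairCoin_value_preimage : fairCoin (value ⁻¹' J) = volume (J ∩ Ico 0 1) := by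
  simpa using fairCoin_value_preimage_inter_cyl hJ []

lemma fairCoin_value_preimage_le : fairCoin (value ⁻¹' J) ≤ volume J :=
  (fairCoin_value_preimage hJ).trans_le (measure_mono inter_subset_left)

end

lemma fairCoin_real_Ici_inter_cyl (u : ℝ) (t : List Bool) :
    fairCoin.real (value ⁻¹' Ici u ∩ cyl t) = max (rightEnd t - max u (leftEnd t)) 0 := by
  have h : Ici u ∩ Ico (leftEnd t) (rightEnd t) = Ico (max u (leftEnd t)) (rightEnd t) := by
    ext r
    simp only [mem_inter_iff, mem_Ici, mem_Ico, max_le_iff, and_assoc]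
  rw [Measure.real, fairCoin_value_preimage_inter_cyl measurableSet_Ici, h, ← Measure.real,
    Real.volume_real_Ico]

lemma fairCoin_real_Ico_inter_cyl (u v : ℝ) (t : List Bool) :
    fairCoin.real (value ⁻¹' Ico u v ∩ cyl t) =
      max (min v (rightEnd t) - max u (leftEnd t)) 0 := by
  rw [Measure.real, fairCoin_value_preimage_inter_cyl measurableSet_Ico, Ico_inter_Ico,
    ← Measure.real, Real.volume_real_Ico]

lemma fairCoin_Ici {u : ℝ} (hu : 0 ≤ u) :
    fairCoin (value ⁻¹' Ici u) = ENNReal.ofReal (1 - u) := by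
  have h := fairCoin_real_Ici_inter_cyl u []
  rw [cyl_nil, inter_univ, leftEnd_nil, rightEnd_nil, max_eq_left hu] at h
  rw [← ofReal_measureReal, h, ENNReal.ofReal_max, ENNReal.ofReal_zero, max_zero]

lemma fairCoin_Ico_ne_zero {u v : ℝ} (huv : u < v) (hu : u < 1) (hv : 0 < v) :
    fairCoin (value ⁻¹' Ico u v) ≠ 0 := by
  rw [fairCoin_value_preimage measurableSet_Ico, Ico_inter_Ico, Real.volume_Ico]
  simp [huv, hu, hv]

lemma fairCoin_Ici_ne_zero {u : ℝ} (hu : u < 1) : fairCoin (value ⁻¹' Ici u) ≠ 0 := fun h =>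
  fairCoin_Ico_ne_zero hu hu one_pos (measure_mono_null (preimage_mono Ico_subset_Ici_self) h)

/-! ### Computable dyadic rationals -/

/-- A function with values in the nonnegative dyadic rationals, given by computable numerators and
computable binary logarithms of the denominators. Such functions have a decidable order, unlike
arbitrary computable reals. -/
def ComputableDyadic {α : Type*} [Primcodable α] (f : α → ℝ) : Prop :=
  ∃ N D : α → ℕ, Computable N ∧ Computable D ∧ ∀ a, f a = N a / 2 ^ D a

lemma primrec_two_pow : Primrec fun n : ℕ => 2 ^ n :=
  (Primrec₂.unpaired'.1 Nat.Primrec.pow).comp (.const 2) .id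

lemma computablePred_and {α : Type*} [Primcodable α] {p q : α → Prop} (hp : ComputablePred p)
    (hq : ComputablePred q) : ComputablePred fun a => p a ∧ q a := by
  classical
  exact ⟨inferInstance, (Primrec.and.to_comp.comp hp.decide hq.decide).of_eq (by simp)⟩

namespace ComputableDyadic

variable {α β : Type*} [Primcodable α] [Primcodable β] {f g : α → ℝ}

lemma comp (hf : ComputableDyadic f) {h : β → α} (hh : Computable h) :
    ComputableDyadic fun b => f (h b) :=
  let ⟨N, D, hN, hD, hfND⟩ := hf
  ⟨fun b => N (h b), fun b => D (h b), hN.comp hh, hD.comp hh, fun b => hfND (h b)⟩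

lemma natCast {h : α → ℕ} (hh : Computable h) : ComputableDyadic fun a => (h a : ℝ) :=
  ⟨h, fun _ => 0, hh, .const 0, fun a => by simp⟩

lemma one_div_two_pow {h : α → ℕ} (hh : Computable h) :
    ComputableDyadic fun a => (1 : ℝ) / 2 ^ h a :=
  ⟨fun _ => 1, h, .const 1, hh, fun a => by simp⟩

lemma exists_common_denominator (hf : ComputableDyadic f) (hg : ComputableDyadic g) :
    ∃ M N D : α → ℕ, Computable M ∧ Computable N ∧ Computable D ∧
      (∀ a, f a = M a / 2 ^ D a) ∧ ∀ a, g a = N a / 2 ^ D a := by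
  obtain ⟨M, D, hM, hD, hfMD⟩ := hf
  obtain ⟨N, E, hN, hE, hgNE⟩ := hg
  refine ⟨fun a => M a * 2 ^ E a, fun a => N a * 2 ^ D a, fun a => D a + E a,
    Primrec.nat_mul.to_comp.comp hM (primrec_two_pow.to_comp.comp hE),
    Primrec.nat_mul.to_comp.comp hN (primrec_two_pow.to_comp.comp hD),
    Primrec.nat_add.to_comp.comp hD hE, fun a => ?_, fun a => ?_⟩
  · rw [hfMD, pow_add]
    push_cast
    field
  · rw [hgNE, pow_add]
    push_cast
    field

protected lemma add (hf : ComputableDyadic f) (hg : ComputableDyadic g) :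
    ComputableDyadic fun a => f a + g a := by
  obtain ⟨M, N, D, hM, hN, hD, hfM, hgN⟩ := exists_common_denominator hf hg
  refine ⟨fun a => M a + N a, D, Primrec.nat_add.to_comp.comp hM hN, hD, fun a => ?_⟩
  simp only [hfM, hgN, ← add_div, Nat.cast_add]

lemma max_sub_zero (hf : ComputableDyadic f) (hg : ComputableDyadic g) :
    ComputableDyadic fun a => max (f a - g a) 0 := by
  obtain ⟨M, N, D, hM, hN, hD, hfM, hgN⟩ := exists_common_denominator hf hg
  refine ⟨fun a => M a - N a, D, Primrec.nat_sub.to_comp.comp hM hN, hD, fun a => ?_⟩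
  dsimp only
  rw [hfM, hgN, ← sub_div, ← zero_div (2 ^ D a : ℝ), max_div_div_right (by positivity)]
  congr 1
  rcases le_total (N a) (M a) with h | h
  · rw [Nat.cast_sub h, max_eq_left (sub_nonneg.2 (Nat.cast_le.2 h))]
  · rw [Nat.sub_eq_zero_of_le h, max_eq_right (sub_nonpos.2 (Nat.cast_le.2 h)), Nat.cast_zero]

protected lemma sub (hf : ComputableDyadic f) (hg : ComputableDyadic g) (h : ∀ a, g a ≤ f a) :
    ComputableDyadic fun a => f a - g a := by
  simpa only [max_eq_left (sub_nonneg.2 (h _))] using max_sub_zero hf hg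

protected lemma mul (hf : ComputableDyadic f) (hg : ComputableDyadic g) :
    ComputableDyadic fun a => f a * g a := by
  obtain ⟨M, D, hM, hD, hfMD⟩ := hf
  obtain ⟨N, E, hN, hE, hgNE⟩ := hg
  refine ⟨fun a => M a * N a, fun a => D a + E a, Primrec.nat_mul.to_comp.comp hM hN,
    Primrec.nat_add.to_comp.comp hD hE, fun a => ?_⟩
  simp only [hfMD, hgNE, div_mul_div_comm, pow_add, Nat.cast_mul]

lemma computablePred_le (hf : ComputableDyadic f) (hg : ComputableDyadic g) :
    ComputablePred fun a => f a ≤ g a := by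
  obtain ⟨M, N, D, hM, hN, -, hfM, hgN⟩ := exists_common_denominator hf hg
  refine ComputablePred.of_eq (p := fun a => M a ≤ N a)
    ⟨inferInstance, Primrec.nat_le.decide.to_comp.comp hM hN⟩ fun a => ?_
  rw [hfM, hgN, div_le_div_iff_of_pos_right (by positivity), Nat.cast_le]

protected lemma ite {p : α → Prop} [DecidablePred p] (hp : ComputablePred p)
    (hf : ComputableDyadic f) (hg : ComputableDyadic g) :
    ComputableDyadic fun a => if p a then f a else g a := by
  obtain ⟨M, N, D, hM, hN, hD, hfM, hgN⟩ := exists_common_denominator hf hg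
  refine ⟨fun a => bif decide (p a) then M a else N a, D, .cond hp.decide hM hN, hD, fun a => ?_⟩
  by_cases h : p a <;> simp [h, hfM, hgN]

protected lemma max (hf : ComputableDyadic f) (hg : ComputableDyadic g) :
    ComputableDyadic fun a => max (f a) (g a) := by
  simp only [max_def]
  exact .ite (hf.computablePred_le hg) hg hf

protected lemma min (hf : ComputableDyadic f) (hg : ComputableDyadic g) :
    ComputableDyadic fun a => min (f a) (g a) := by
  simp only [min_def]
  exact .ite (hf.computablePred_le hg) hf hg

lemma exists_approximation (hf : ComputableDyadic f) :
    ∃ q : α × ℕ → ℕ, Computable q ∧ ∀ a k, |f a - q (a, k) / 2 ^ k| ≤ 1 / 2 ^ k := by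
  obtain ⟨N, D, hN, hD, hfND⟩ := hf
  refine ⟨fun a => N a.1 * 2 ^ a.2 / 2 ^ D a.1, Primrec.nat_div.to_comp.comp
    (Primrec.nat_mul.to_comp.comp (hN.comp .fst) (primrec_two_pow.to_comp.comp .snd))
    (primrec_two_pow.to_comp.comp (hD.comp .fst)), fun a k => ?_⟩
  have hk : (0 : ℝ) < 2 ^ k := by positivity
  have hfloor : N a * 2 ^ k / 2 ^ D a = ⌊f a * 2 ^ k⌋₊ := by
    rw [← Nat.floor_div_eq_div (K := ℝ), hfND]
    push_cast
    rw [div_mul_eq_mul_div]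
  have hnonneg : 0 ≤ f a * 2 ^ k := by
    rw [hfND]
    positivity
  have hle := Nat.floor_le hnonneg
  have hlt := Nat.lt_floor_add_one (f a * 2 ^ k)
  dsimp only
  rw [hfloor, sub_div' hk.ne', abs_div, abs_of_pos hk, div_le_div_iff_of_pos_right hk, abs_le]
  constructor <;> linarith

end ComputableDyadic

lemma primrec_natValue : Primrec natValue :=
  Primrec.list_foldl .id (.const 0) (Primrec.nat_add.comp
    (Primrec.nat_mul.comp (.const 2) (Primrec.fst.comp .snd))
    ((Primrec.dom_finite Bool.toNat).comp (Primrec.snd.comp .snd))).to₂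

lemma computableDyadic_leftEnd : ComputableDyadic leftEnd :=
  ⟨natValue, List.length, primrec_natValue.to_comp, .list_length, fun _ => rfl⟩

lemma computableDyadic_rightEnd : ComputableDyadic rightEnd := by
  rw [funext rightEnd_eq]
  exact computableDyadic_leftEnd.add (.one_div_two_pow .list_length)

/-! ### Effectively open sets -/

open Encodable (encode decode)
open Nat.Partrec (Code)
open Nat.Partrec.Code (evaln evaln_complete)

section

variable {ι γ X : Type} [Primcodable ι] [Primcodable γ] {basic : ι → Set X}

lemma uniformlyEffectivelyOpenIn_of_computablePred (O : Set (ℕ →. ℕ)) (basic : ι → Set X)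
    {p : (ℕ × ι) × γ → Prop} (hp : ComputablePred p) :
    UniformlyEffectivelyOpenIn O basic fun n => ⋃ i ∈ {i | ∃ c, p ((n, i), c)}, basic i := by
  classical
  let search (a : ℕ × ι) (k : ℕ) : Bool :=
    ((decode k : Option γ).map fun c => decide (p (a, c))).getD false
  have hsearch : Computable₂ search :=
    .option_getD (.option_map (.comp .decode .snd)
      (hp.decide.comp (.pair (.comp .fst .fst) .snd))) (.const false)
  have hdom (a : ℕ × ι) : (Nat.rfind (search a : ℕ →. Bool)).Dom ↔ ∃ c, p (a, c) := by
    simp only [Nat.rfind_dom, PFun.coe_val, Part.mem_some_iff, Part.some_dom, implies_true,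
      and_true]
    constructor
    · rintro ⟨k, hk⟩
      cases hc : (decode k : Option γ) with
      | none => simp [search, hc] at hk
      | some c => exact ⟨c, by simpa [search, hc] using hk.symm⟩
    · rintro ⟨c, hc⟩
      exact ⟨encode c, by simpa [search] using hc⟩
  exact ⟨_, ((Partrec.rfind hsearch.partrec₂).map (Computable.const ()).to₂).recursiveIn,
    fun n => by simp only [Part.map_Dom, hdom]⟩

lemma UniformlyEffectivelyOpenIn.exists_code {U : ℕ → Set X}
    (hU : UniformlyEffectivelyOpenIn ∅ basic U) :
    ∃ c : Code, ∀ n, U n = ⋃ i ∈ {i | ∃ s, (evaln s c (encode (n, i))).isSome}, basic i := by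
  obtain ⟨f, hf, hUf⟩ := hU
  obtain ⟨c, hc⟩ :=
    Nat.Partrec.Code.exists_code.1 (recursiveIn_empty_iff.1 hf)
  refine ⟨c, fun n => ?_⟩
  have hdom (i : ι) : (f (n, i)).Dom ↔ ∃ s, (evaln s c (encode (n, i))).isSome := by
    have heval : (f (n, i)).Dom ↔ (c.eval (encode (n, i))).Dom := by simp [hc]
    rw [heval, Part.dom_iff_mem]
    simp only [evaln_complete, Option.isSome_iff_exists]
    exact exists_comm
  simp only [hUf, hdom]

end

/-! ### Existence of Chaitin's number -/

lemma primrec₂_binaryString : Primrec₂ binaryString := by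
  refine Primrec.list_map (Primrec.list_range.comp .fst) (Primrec.of_eq
    (f := fun a : (ℕ × ℕ) × ℕ => decide (a.1.2 / 2 ^ (a.1.1 - 1 - a.2) % 2 = 1)) ?_
    fun a => Nat.testBit_eq_decide_div_mod_eq.symm)
  exact Primrec.eq.decide.comp (Primrec.nat_mod.comp (Primrec.nat_div.comp (Primrec.snd.comp .fst)
    (primrec_two_pow.comp (Primrec.nat_sub.comp
      (Primrec.nat_sub.comp (Primrec.fst.comp .fst) (.const 1)) .snd))) (.const 2)) (.const 1)

lemma primrecRel_exists_lt {α : Type*} [Primcodable α] {R : ℕ → α → Prop} (hR : PrimrecRel R) :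
    PrimrecRel fun n a => ∃ x < n, R x a :=
  (hR.exists_mem_list.comp (Primrec.list_range.comp .fst) .snd).of_eq (by simp)

section

variable {p : List Bool → Prop}

lemma exists_computable_isLeast_natValue (hp : PrimrecPred p)
    (hex : ∀ s, ∃ x : Cantor, p (pre x s)) :
    ∃ m : ℕ → ℕ, Computable m ∧
      ∀ s, IsLeast ((fun x => natValue (pre x s)) '' {x | p (pre x s)}) (m s) := by
  classical
  have hbin (s : ℕ) : ∃ m, p (binaryString s m) :=
    let ⟨x, hx⟩ := hex s
    ⟨natValue (pre x s), by simpa⟩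
  have hle {x : Cantor} {s : ℕ} (hx : p (pre x s)) : Nat.find (hbin s) ≤ natValue (pre x s) :=
    Nat.find_min' _ (by simpa)
  refine ⟨_, Computable.find
    (hp.comp (primrec₂_binaryString.comp .fst .snd)).computablePred hbin, fun s => ⟨?_, ?_⟩⟩
  · obtain ⟨x, hx⟩ := hex s
    have hlt := (hle hx).trans_lt (natValue_lt _)
    rw [length_pre] at hlt
    exact ⟨_, Nat.find_spec (hbin s), natValue_binaryString hlt⟩
  · rintro _ ⟨x, hx, rfl⟩
    exact hle hx

variable (hanti : ∀ x : Cantor, Antitone fun s => p (pre x s))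
include hanti

lemma exists_forall_pre_and_value_le {r : ℝ}
    (hex : ∀ s, ∃ x : Cantor, p (pre x s) ∧ value x ≤ r + 1 / 2 ^ s) :
    ∃ x : Cantor, (∀ s, p (pre x s)) ∧ value x ≤ r := by
  set K : ℕ → Set Cantor := fun s => {x | p (pre x s)} ∩ value ⁻¹' Iic (r + 1 / 2 ^ s)
  have hclosed (s : ℕ) : IsClosed (K s) :=
    (isClopen_setOf_pre p s).isClosed.inter (isClosed_Iic.preimage continuous_value)
  have hsucc (s : ℕ) : K (s + 1) ⊆ K s := by
    refine inter_subset_inter (fun x => hanti x s.le_succ) (preimage_mono (Iic_subset_Iic.2 ?_))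
    gcongr
    · exact one_le_two
    · exact s.le_succ
  obtain ⟨x, hx⟩ := IsCompact.nonempty_iInter_of_sequence_nonempty_isCompact_isClosed K hsucc hex
    (hclosed 0).isCompact hclosed
  rw [mem_iInter] at hx
  have hlim := tendsto_one_div_two_pow.const_add r
  rw [add_zero] at hlim
  exact ⟨x, fun s => (hx s).1, ge_of_tendsto' hlim fun s => (hx s).2⟩

lemma exists_lowerSemicomputable_forall_pre (hp : PrimrecPred p)
    (hex : ∀ s, ∃ x : Cantor, p (pre x s)) :
    ∃ x, LowerSemicomputable (value x) ∧ ∀ s, p (pre x s) := by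
  obtain ⟨m, hm, hleast⟩ := exists_computable_isLeast_natValue hp hex
  set a : ℕ → ℝ := fun s => m s / 2 ^ s with ha
  have hle {x : Cantor} {s : ℕ} (hx : p (pre x s)) : a s ≤ leftEnd (pre x s) := by
    rw [leftEnd, length_pre]
    exact div_le_div_of_nonneg_right (Nat.cast_le.2 ((hleast s).2 ⟨x, hx, rfl⟩)) (by positivity)
  have hattained (s : ℕ) : ∃ x : Cantor, p (pre x s) ∧ leftEnd (pre x s) = a s :=
    let ⟨x, hx, hxm⟩ := (hleast s).1
    ⟨x, hx, by simp only [leftEnd, length_pre, ha, ← hxm]⟩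
  have hmono : Monotone a := by
    refine monotone_nat_of_le_succ fun s => ?_
    obtain ⟨x, hx, hxa⟩ := hattained (s + 1)
    exact (hle (hanti x s.le_succ hx)).trans ((monotone_leftEnd_pre x s.le_succ).trans_eq hxa)
  have hbdd : BddAbove (range a) := by
    refine ⟨1, ?_⟩
    rintro _ ⟨s, rfl⟩
    obtain ⟨x, -, hxa⟩ := hattained s
    exact hxa ▸ (leftEnd_lt_rightEnd _).le.trans (rightEnd_le_one _)
  have hlim := tendsto_atTop_ciSup hmono hbdd
  obtain ⟨x, hx, hxr⟩ := exists_forall_pre_and_value_le hanti (r := ⨆ s, a s) fun s => by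
    obtain ⟨x, hx, hxa⟩ := hattained s
    refine ⟨x, hx, (value_mem_Icc (self_mem_cyl_pre x s)).2.trans ?_⟩
    rw [rightEnd_eq, hxa, length_pre]
    gcongr
    exact le_ciSup hbdd s
  have hval : value x = ⨆ s, a s := le_antisymm hxr
    (ciSup_le fun s => (hle (hx s)).trans (value_mem_Icc (self_mem_cyl_pre x s)).1)
  exact ⟨x, ⟨m, id, hm, .id, hmono, hval ▸ hlim⟩, hx⟩

end

lemma exists_lowerSemicomputable_forall_not_pre {p : List Bool → Prop} (hp : PrimrecPred p)
    (hμ : fairCoin {x | ∃ s, p (pre x s)} < 1) :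
    ∃ x, LowerSemicomputable (value x) ∧ ∀ s, ¬ p (pre x s) := by
  have htake : PrimrecRel fun (j : ℕ) (t : List Bool) => p (t.take j) :=
    hp.comp (Primrec.list_take.comp .fst .snd)
  have hprefix : PrimrecPred fun t : List Bool => ¬ ∃ j < t.length + 1, p (t.take j) :=
    ((primrecRel_exists_lt htake).comp (Primrec.succ.comp .list_length) .id).not
  have hiff (x : Cantor) (s : ℕ) :
      (¬ ∃ j < (pre x s).length + 1, p ((pre x s).take j)) ↔ ∀ j ≤ s, ¬ p (pre x j) := by
    simp only [length_pre, Nat.lt_succ_iff, not_exists, not_and]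
    exact forall₂_congr fun j hj => by rw [take_pre x hj]
  obtain ⟨y, hy⟩ : ∃ y : Cantor, ∀ s, ¬ p (pre y s) := by
    by_contra! hall
    rw [eq_univ_of_forall (s := {x | ∃ s, p (pre x s)}) hall, measure_univ] at hμ
    exact hμ.false
  obtain ⟨x, hx, hpx⟩ := exists_lowerSemicomputable_forall_pre
    (fun x s t hst h => (hiff x s).2 fun j hj => (hiff x t).1 h j (hj.trans hst)) hprefix
    fun s => ⟨y, (hiff y s).2 fun j _ => hy j⟩
  exact ⟨x, hx, fun s => (hiff x s).1 (hpx s) s le_rfl⟩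

/-! ### The universal test -/

/-- The infinite sequences that extend `u` belong to the `n`-th level of the test enumerated by the
program `c`, and this is seen after `|u|` steps of the computation. -/
def IsCovered (c : Code) (n : ℕ) (u : List Bool) : Prop :=
  ∃ j < u.length + 1, (evaln u.length c (encode (n, u.take j))).isSome

lemma primrecPred_isCovered :
    PrimrecPred fun a : (Code × ℕ) × List Bool => IsCovered a.1.1 a.1.2 a.2 := by
  have hrel : PrimrecRel fun (j : ℕ) (a : (Code × ℕ) × List Bool) =>
      (evaln a.2.length a.1.1 (encode (a.1.2, a.2.take j))).isSome = true := by
    have hcode : Primrec fun z : ℕ × (Code × ℕ) × List Bool => z.2.1.1 :=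
      Primrec.fst.comp (Primrec.fst.comp .snd)
    have hstring : Primrec fun z : ℕ × (Code × ℕ) × List Bool => z.2.2 := Primrec.snd.comp .snd
    have hinput : Primrec fun z : ℕ × (Code × ℕ) × List Bool => (z.2.1.2, z.2.2.take z.1) :=
      (Primrec.snd.comp (Primrec.fst.comp .snd)).pair (Primrec.list_take.comp .fst hstring)
    have heval : Primrec fun z : ℕ × (Code × ℕ) × List Bool =>
        evaln z.2.2.length z.2.1.1 (encode (z.2.1.2, z.2.2.take z.1)) :=
      Code.primrec_evaln.comp
        (((Primrec.list_length.comp hstring).pair hcode).pair (Primrec.encode.comp hinput))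
    exact Primrec.eq.comp (Primrec.option_isSome.comp heval) (.const true)
  exact (primrecRel_exists_lt hrel).comp
    (Primrec.succ.comp (Primrec.list_length.comp .snd)) .id

lemma isCovered_pre_iff {c : Code} {n s : ℕ} {x : Cantor} :
    IsCovered c n (pre x s) ↔ ∃ j ≤ s, (evaln s c (encode (n, pre x j))).isSome := by
  simp only [IsCovered, length_pre, Nat.lt_succ_iff]
  exact exists_congr fun j => and_congr_right fun hj => by rw [take_pre x hj]

lemma monotone_isCovered_pre (c : Code) (n : ℕ) (x : Cantor) :
    Monotone fun s => IsCovered c n (pre x s) := by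
  intro s t hst h
  obtain ⟨j, hj, hs⟩ := isCovered_pre_iff.1 h
  obtain ⟨v, hv⟩ := Option.isSome_iff_exists.1 hs
  exact isCovered_pre_iff.2
    ⟨j, hj.trans hst, Option.isSome_iff_exists.2 ⟨v, Code.evaln_mono hst hv⟩⟩

lemma mem_biUnion_evaln_iff {c : Code} {n : ℕ} {x : Cantor} :
    x ∈ ⋃ t ∈ {t | ∃ s, (evaln s c (encode (n, t))).isSome}, cyl t ↔
      ∃ s, IsCovered c n (pre x s) := by
  simp only [mem_iUnion₂, mem_ofPred_eq, isCovered_pre_iff, exists_prop, mem_cyl_iff]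
  constructor
  · rintro ⟨t, ⟨s, hs⟩, hx⟩
    obtain ⟨v, hv⟩ := Option.isSome_iff_exists.1 hs
    exact ⟨max t.length s, t.length, le_max_left _ _, Option.isSome_iff_exists.2
      ⟨v, hx.symm ▸ Code.evaln_mono (le_max_right _ _) hv⟩⟩
  · rintro ⟨s, j, -, hs⟩
    exact ⟨pre x j, ⟨s, hs⟩, by rw [length_pre]⟩

/-- The part of the `n`-th level of the test enumerated by `c` that is seen after `s` steps obeys
the measure bound of Martin-Löf tests. -/
def IsLegal (c : Code) (n s : ℕ) : Prop :=
  fairCoin {x | IsCovered c n (pre x s)} ≤ 1 / 2 ^ n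

lemma primrecPred_isLegal : PrimrecPred fun a : (Code × ℕ) × ℕ => IsLegal a.1.1 a.1.2 a.2 := by
  classical
  have hrel : PrimrecRel fun (m : ℕ) (a : (Code × ℕ) × ℕ) =>
      IsCovered a.1.1 a.1.2 (binaryString a.2 m) :=
    primrecPred_isCovered.comp ((Primrec.fst.comp .snd).pair
      (primrec₂_binaryString.comp (Primrec.snd.comp .snd) .fst))
  have hcount : Primrec fun a : (Code × ℕ) × ℕ =>
      Nat.count (fun m => IsCovered a.1.1 a.1.2 (binaryString a.2 m)) (2 ^ a.2) := by
    simp only [Nat.count, List.countP_eq_length_filter]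
    exact Primrec.list_length.comp ((PrimrecRel.listFilter hrel).comp
      (Primrec.list_range.comp (primrec_two_pow.comp .snd)) .id)
  refine PrimrecPred.of_eq (Primrec.nat_le.comp (Primrec.nat_mul.comp hcount
    (primrec_two_pow.comp (Primrec.snd.comp .fst))) (primrec_two_pow.comp .snd)) fun a => ?_
  rw [IsLegal, fairCoin_setOf_pre, ENNReal.div_le_iff (by simp) (by simp), one_div, mul_comm,
    ← ENNReal.div_eq_inv_mul, ENNReal.le_div_iff_mul_le (by simp) (by simp), mul_comm]
  norm_cast

/-- One of the programs `e < |u|` covers the extensions of `u` by what is seen of level `e + 2` of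
its test, and this part of the level is legal. Choosing a different level for every program keeps
the total measure of the excluded sequences below `1`. -/
def IsExcluded (u : List Bool) : Prop :=
  ∃ e < u.length, IsCovered (Denumerable.ofNat Code e) (e + 2) u ∧
    IsLegal (Denumerable.ofNat Code e) (e + 2) u.length

lemma primrecPred_isExcluded : PrimrecPred IsExcluded := by
  have hcode : Primrec fun a : ℕ × List Bool => (Denumerable.ofNat Code a.1, a.1 + 2) :=
    ((Primrec.ofNat Code).comp .fst).pair (Primrec.nat_add.comp .fst (.const 2))
  have hcov := primrecPred_isCovered.comp (hcode.pair .snd)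
  have hlegal := primrecPred_isLegal.comp (hcode.pair (Primrec.list_length.comp .snd))
  have hrel : PrimrecRel fun (e : ℕ) (u : List Bool) =>
      IsCovered (Denumerable.ofNat Code e) (e + 2) u ∧
        IsLegal (Denumerable.ofNat Code e) (e + 2) u.length := hcov.and hlegal
  exact (primrecRel_exists_lt hrel).comp .list_length .id

lemma measure_biUnion_le_of_monotone {α : Type*} [MeasurableSpace α] {μ : Measure α}
    {S : ℕ → Set α} (hS : Monotone S) (b : ENNReal) :
    μ (⋃ s ∈ {s | μ (S s) ≤ b}, S s) ≤ b := by
  rw [measure_biUnion_eq_iSup (to_countable _)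
    (DirectedOn.of_linearOrder _ |>.mono fun s t h => hS h)]
  exact iSup₂_le fun s hs => hs

lemma fairCoin_isExcluded_lt_one : fairCoin {x | ∃ s, IsExcluded (pre x s)} < 1 := by
  set S : ℕ → ℕ → Set Cantor :=
    fun e s => {x | IsCovered (Denumerable.ofNat Code e) (e + 2) (pre x s)}
  have hsub : {x | ∃ s, IsExcluded (pre x s)} ⊆
      ⋃ e, ⋃ s ∈ {s | fairCoin (S e s) ≤ 1 / 2 ^ (e + 2)}, S e s := by
    rintro x ⟨s, e, -, hcov, hle⟩
    rw [length_pre] at hle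
    exact mem_iUnion.2 ⟨e, mem_biUnion (mem_ofPred.2 hle) hcov⟩
  have hsum : ∑' e : ℕ, (1 / 2 ^ (e + 2) : ENNReal) = 1 / 2 := by
    have hpow (e : ℕ) : (1 / 2 ^ (e + 2) : ENNReal) = 2⁻¹ ^ (e + 1) * 2⁻¹ := by
      rw [one_div, ENNReal.inv_pow, pow_succ (2 : ENNReal)⁻¹ (e + 1)]
    rw [tsum_congr hpow, ENNReal.tsum_mul_right, ENNReal.tsum_geometric_add_one,
      ENNReal.one_sub_inv_two, inv_inv, ENNReal.inv_mul_cancel two_ne_zero ENNReal.ofNat_ne_top,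
      one_mul, one_div]
  calc
    fairCoin {x | ∃ s, IsExcluded (pre x s)}
      ≤ ∑' e, fairCoin (⋃ s ∈ {s | fairCoin (S e s) ≤ 1 / 2 ^ (e + 2)}, S e s) :=
        (measure_mono hsub).trans (measure_iUnion_le _)
    _ ≤ ∑' e : ℕ, 1 / 2 ^ (e + 2) := ENNReal.tsum_le_tsum fun e =>
        measure_biUnion_le_of_monotone (fun _ _ hst x => monotone_isCovered_pre _ _ x hst) _
    _ = 1 / 2 := hsum
    _ < 1 := by simp

lemma mlRandom_of_forall_not_isExcluded {x : Cantor} (hx : ∀ s, ¬ IsExcluded (pre x s)) :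
    MLRandom fairCoin x := by
  rintro U ⟨hU, hμ⟩ hmem
  obtain ⟨c, hc⟩ := hU.exists_code
  have hcov {y : Cantor} : y ∈ U (encode c + 2) ↔ ∃ s, IsCovered c (encode c + 2) (pre y s) := by
    rw [hc, mem_biUnion_evaln_iff]
  obtain ⟨s, hs⟩ := hcov.1 (mem_iInter.1 hmem _)
  refine hx (max s (encode c + 1)) ⟨encode c, ?_, ?_, ?_⟩
  · rw [length_pre]
    exact (Nat.lt_succ_self _).trans_le (le_max_right _ _)
  · rw [Denumerable.ofNat_encode]
    exact monotone_isCovered_pre _ _ _ (le_max_left _ _) hs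
  · rw [Denumerable.ofNat_encode]
    exact (measure_mono fun y hy => hcov.2 ⟨_, hy⟩).trans (hμ _)

theorem exists_isOmegaNumber : ∃ x, IsOmegaNumber x :=
  let ⟨x, hlower, hx⟩ := exists_lowerSemicomputable_forall_not_pre primrecPred_isExcluded
    fairCoin_isExcluded_lt_one
  ⟨x, hlower, mlRandom_of_forall_not_isExcluded hx⟩

/-! ### Random lower semicomputable reals -/

section

variable {x : Cantor}

lemma MLRandom.value_ne (hx : MLRandom fairCoin x) (N D : ℕ) : value x ≠ N / 2 ^ D := by
  intro hxr
  set r : ℝ := N / 2 ^ D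
  have hr {α : Type} [Primcodable α] : ComputableDyadic fun _ : α => r :=
    ⟨fun _ => N, fun _ => D, .const N, .const D, fun _ => rfl⟩
  have hlength : ComputablePred fun a : (ℕ × List Bool) × Unit => a.1.2.length = a.1.1 + 1 :=
    (Primrec.eq.comp (Primrec.list_length.comp (Primrec.snd.comp .fst))
      (Primrec.succ.comp (Primrec.fst.comp .fst))).computablePred
  have hstring : Computable fun a : (ℕ × List Bool) × Unit => a.1.2 := .comp .snd .fst
  have hnear := computablePred_and hlength (computablePred_and
    ((computableDyadic_leftEnd.comp hstring).computablePred_le hr)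
    (hr.computablePred_le (computableDyadic_rightEnd.comp hstring)))
  refine hx _ ⟨uniformlyEffectivelyOpenIn_of_computablePred ∅ cyl hnear, fun n => ?_⟩
    (mem_iInter.2 fun n => ?_)
  · set ε : ℝ := 1 / 2 ^ (n + 1) with hε
    calc
      _ ≤ fairCoin (value ⁻¹' Icc (r - ε) (r + ε)) := measure_mono ?_
      _ ≤ volume (Icc (r - ε) (r + ε)) := fairCoin_value_preimage_le measurableSet_Icc
      _ = ENNReal.ofReal (1 / 2 ^ n) := by
        rw [Real.volume_Icc, hε, pow_succ]
        congr 1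
        field
      _ = 1 / 2 ^ n := ofReal_one_div_two_pow n
    refine iUnion₂_subset fun t ⟨_, ht, hleft, hright⟩ y hy => ?_
    have hwidth : rightEnd t = leftEnd t + ε := by rw [rightEnd_eq, ht, hε]
    have hmem := value_mem_Icc hy
    exact ⟨by linarith [hmem.1], by linarith [hmem.2]⟩
  · have hmem := value_mem_Icc (self_mem_cyl_pre x (n + 1))
    exact mem_biUnion ⟨(), length_pre .., hxr ▸ hmem.1, hxr ▸ hmem.2⟩ (self_mem_cyl_pre x (n + 1))

lemma MLRandom.value_pos (hx : MLRandom fairCoin x) : 0 < value x :=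
  (value_nonneg x).lt_of_ne' (by simpa using hx.value_ne 0 0)

lemma MLRandom.value_lt_one (hx : MLRandom fairCoin x) : value x < 1 :=
  (value_le_one x).lt_of_ne (by simpa using hx.value_ne 1 0)

end

lemma LowerSemicomputable.exists_strictMono {r : ℝ} (hr : LowerSemicomputable r) (hpos : 0 < r) :
    ∃ a : ℕ → ℝ, ComputableDyadic a ∧ a 0 = 0 ∧ StrictMono a ∧ Tendsto a atTop (𝓝 r) := by
  obtain ⟨p, e, hp, he, hmono, hlim⟩ := hr
  set q : ℕ → ℝ := fun k => p k / 2 ^ e k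
  have hq : ComputableDyadic q := ⟨p, e, hp, he, fun _ => rfl⟩
  obtain ⟨N, hN⟩ := (hlim.eventually_const_lt hpos).exists
  have hanti : StrictAnti fun k : ℕ => (1 : ℝ) / 2 ^ k := by
    simpa only [one_div_pow] using
      pow_right_strictAnti₀ (one_half_pos (α := ℝ)) one_half_lt_one
  have hle (k : ℕ) : (1 : ℝ) / 2 ^ k ≤ 1 := by simpa using hanti.antitone k.zero_le
  refine ⟨fun k => q (k + N) * (1 - 1 / 2 ^ k), ?_, by simp, ?_, ?_⟩
  · have hone : ComputableDyadic fun _ : ℕ => (1 : ℝ) := by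
      simpa using ComputableDyadic.natCast (Computable.const (α := ℕ) 1)
    exact (hq.comp (Primrec.nat_add.comp .id (.const N)).to_comp).mul
      (hone.sub (.one_div_two_pow .id) hle)
  · refine strictMono_nat_of_lt_succ fun k => ?_
    have hqle : q (k + N) ≤ q (k + 1 + N) := hmono (by lia)
    have hqpos : 0 < q (k + 1 + N) := hN.trans_le (hmono (by lia))
    exact (mul_le_mul_of_nonneg_right hqle (sub_nonneg.2 (hle k))).trans_lt
      (mul_lt_mul_of_pos_left (sub_lt_sub_left (hanti k.lt_succ_self) 1) hqpos)
  · simpa using!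
      (hlim.comp (tendsto_add_atTop_nat N)).mul (tendsto_one_div_two_pow.const_sub 1)

/-! ### The joint measure and its conditional measures -/

/-- The sequence `0ᵏ1` followed by digits of `z.2` when `value z.1` lies in `[a k, a (k + 1))`, and
the zero sequence when `value z.1` lies above all `a k`. -/
noncomputable def locate (a : ℕ → ℝ) (z : Cantor × Cantor) : Cantor := fun i =>
  if a (i + 1) ≤ value z.1 then false else if a i ≤ value z.1 then true else z.2 i

/-- The joint distribution of the location of `value x` among the `a k` and of `x`, for random
`x`. -/
noncomputable def jointMeasure (a : ℕ → ℝ) : Measure (Cantor × Cantor) :=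
  (fairCoin.prod fairCoin).map fun z => (locate a z, z.1)

lemma measurable_locate (a : ℕ → ℝ) : Measurable (locate a) := by
  have hvalue : Measurable fun z : Cantor × Cantor => value z.1 :=
    measurable_value.comp measurable_fst
  exact measurable_pi_iff.2 fun i =>
    .ite (measurableSet_le measurable_const hvalue) measurable_const
      (.ite (measurableSet_le measurable_const hvalue) measurable_const
        ((measurable_pi_apply i).comp measurable_snd))

lemma measurable_locate_fst (a : ℕ → ℝ) :
    Measurable fun z : Cantor × Cantor => (locate a z, z.1) :=
  (measurable_locate a).prodMk measurable_fst

instance (a : ℕ → ℝ) : IsProbabilityMeasure (jointMeasure a) :=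
  Measure.isProbabilityMeasure_map (measurable_locate_fst a).aemeasurable

lemma jointMeasure_cyl_pre_prod (a : ℕ → ℝ) (b : Cantor) (n : ℕ) {T : Set Cantor}
    (hT : MeasurableSet T) :
    jointMeasure a (cyl (pre b n) ×ˢ T) =
      fairCoin.prod fairCoin {z | (∀ i < n, locate a z i = b i) ∧ z.1 ∈ T} := by
  rw [jointMeasure, Measure.map_apply (measurable_locate_fst a) ((measurableSet_cyl _).prod hT)]
  congr 1
  ext z
  simp only [mem_preimage, mem_prod, mem_cyl_pre, mem_ofPred_eq]

section

variable {a : ℕ → ℝ} (ha : StrictMono a)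
include ha

lemma locate_of_value_lt {z : Cantor × Cantor} {k i : ℕ} (hz : value z.1 < a (k + 1))
    (hi : k + 1 ≤ i) : locate a z i = z.2 i := by
  have hzi := hz.trans_le (ha.monotone hi)
  rw [locate, if_neg (hzi.trans (ha i.lt_succ_self)).not_ge, if_neg hzi.not_ge]

variable (h0 : a 0 = 0)
include h0

lemma forall_locate_eq_false_iff {z : Cantor × Cantor} {n : ℕ} :
    (∀ i < n, locate a z i = false) ↔ a n ≤ value z.1 := by
  constructor
  · intro h
    induction n with
    | zero => exact h0 ▸ value_nonneg z.1
    | succ n ih =>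
      have hle := ih fun i hi => h i (by lia)
      have hn := h n n.lt_succ_self
      by_contra hlt
      simp [locate, hle, hlt] at hn
  · intro h i hi
    rw [locate, if_pos ((ha.monotone hi).trans h)]

section

variable {b : Cantor} {k : ℕ} (hb : ∀ i < k, b i = false) (hk : b k = true)
include hb hk

lemma forall_locate_eq_iff {z : Cantor × Cantor} {n : ℕ} (hkn : k < n) :
    (∀ i < n, locate a z i = b i) ↔
      value z.1 ∈ Ico (a k) (a (k + 1)) ∧ ∀ i ∈ Finset.Ico (k + 1) n, z.2 i = b i := by
  simp only [mem_Ico, Finset.mem_Ico]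
  constructor
  · intro h
    have hge : a k ≤ value z.1 := (forall_locate_eq_false_iff ha h0).1 fun i hi =>
      (h i (hi.trans hkn)).trans (hb i hi)
    have hlt : value z.1 < a (k + 1) := by
      by_contra hle
      have := h k hkn
      simp [locate, hk, not_lt.1 hle] at this
    exact ⟨⟨hge, hlt⟩, fun i hi => locate_of_value_lt ha hlt hi.1 ▸ h i hi.2⟩
  · rintro ⟨⟨hge, hlt⟩, h⟩ i hi
    rcases lt_trichotomy i k with hik | rfl | hik
    · rw [hb i hik, (forall_locate_eq_false_iff ha h0).2 hge i hik]
    · rw [locate, if_neg hlt.not_ge, if_pos hge, hk]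
    · rw [locate_of_value_lt ha hlt hik, h i ⟨hik, hi⟩]

lemma jointMeasure_of_first_true {n : ℕ} (hkn : k < n) {T : Set Cantor} (hT : MeasurableSet T) :
    jointMeasure a (cyl (pre b n) ×ˢ T) =
      1 / 2 ^ (n - (k + 1)) * fairCoin (value ⁻¹' Ico (a k) (a (k + 1)) ∩ T) := by
  have hset : {z | (∀ i < n, locate a z i = b i) ∧ z.1 ∈ T} =
      (value ⁻¹' Ico (a k) (a (k + 1)) ∩ T) ×ˢ {y | ∀ i ∈ Finset.Ico (k + 1) n, y i = b i} := by
    ext z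
    rw [mem_ofPred_eq, forall_locate_eq_iff ha h0 hb hk hkn]
    exact and_right_comm
  rw [jointMeasure_cyl_pre_prod a b n hT, hset, Measure.prod_prod, fairCoin_forall_mem_eq,
    Nat.card_Ico, mul_comm]

end

lemma jointMeasure_of_false {b : Cantor} {n : ℕ} (hb : ∀ i < n, b i = false) {T : Set Cantor}
    (hT : MeasurableSet T) :
    jointMeasure a (cyl (pre b n) ×ˢ T) = fairCoin (value ⁻¹' Ici (a n) ∩ T) := by
  have hset : {z | (∀ i < n, locate a z i = b i) ∧ z.1 ∈ T} =
      (value ⁻¹' Ici (a n) ∩ T) ×ˢ univ := by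
    ext z
    simp only [mem_ofPred_eq, mem_prod, mem_inter_iff, mem_preimage, mem_Ici, mem_univ, and_true,
      ← forall_locate_eq_false_iff ha h0]
    exact and_congr_left fun _ => forall₂_congr fun i hi => by rw [hb i hi]
  rw [jointMeasure_cyl_pre_prod a b n hT, hset, Measure.prod_prod, measure_univ, mul_one]

lemma jointMeasure_real_rect (s t : List Bool) :
    (jointMeasure a).real (rect (s, t)) =
      if s.findIdx id < s.length then
        1 / 2 ^ (s.length - (s.findIdx id + 1)) *
          max (min (a (s.findIdx id + 1)) (rightEnd t) - max (a (s.findIdx id)) (leftEnd t)) 0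
      else max (rightEnd t - max (a (s.findIdx id)) (leftEnd t)) 0 := by
  set k := s.findIdx id
  set b : Cantor := fun i => s.getD i false
  have hs : rect (s, t) = cyl (pre b s.length) ×ˢ cyl t := by rw [pre_getD, rect]
  have hfalse : ∀ i < k, b i = false := fun i hi => by
    have hlen : i < s.length := hi.trans_le List.findIdx_le_length
    simpa [b, hlen] using List.not_of_lt_findIdx hi
  rw [hs, Measure.real]
  split_ifs with hlen
  · have htrue : b k = true := by simpa [b, hlen] using List.findIdx_getElem (w := hlen)
    rw [jointMeasure_of_first_true ha h0 hfalse htrue hlen (measurableSet_cyl t),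
      ENNReal.toReal_mul, ← Measure.real, fairCoin_real_Ico_inter_cyl, ← ofReal_one_div_two_pow,
      ENNReal.toReal_ofReal (by positivity)]
  · have hk : s.length = k := (not_lt.1 hlen).antisymm List.findIdx_le_length
    rw [hk, jointMeasure_of_false ha h0 hfalse (measurableSet_cyl t), ← Measure.real,
      fairCoin_real_Ici_inter_cyl]

lemma computableMeasure_jointMeasure (hac : ComputableDyadic a) :
    ComputableMeasure (jointMeasure a) := by
  have hindex : Primrec fun p : List Bool × List Bool => p.1.findIdx id :=
    Primrec.list_findIdx .fst Primrec.snd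
  have hlength : Primrec fun p : List Bool × List Bool => p.1.length :=
    Primrec.list_length.comp .fst
  have hsucc := Primrec.succ.comp hindex
  have hleft := (hac.comp hindex.to_comp).max (computableDyadic_leftEnd.comp .snd)
  have hright := computableDyadic_rightEnd.comp (Computable.snd (α := List Bool))
  have htail := hright.max_sub_zero hleft
  have hpiece := ((hac.comp hsucc.to_comp).min hright).max_sub_zero hleft
  have hdigits := ComputableDyadic.one_div_two_pow (Primrec.nat_sub.comp hlength hsucc).to_comp
  have hlt := (Primrec.nat_lt.comp hindex hlength).computablePred
  obtain ⟨q, hq, happrox⟩ :=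
    (ComputableDyadic.ite hlt (hdigits.mul hpiece) htail).exists_approximation
  exact ⟨q, hq, fun p k => jointMeasure_real_rect ha h0 p.1 p.2 ▸ happrox p k⟩

lemma isConditionalMeasure_of_first_true (ha1 : ∀ n, a n < 1) {b : Cantor} {k : ℕ}
    (hb : ∀ i < k, b i = false) (hk : b k = true) :
    IsConditionalMeasure (jointMeasure a) b
      (ProbabilityTheory.cond fairCoin (value ⁻¹' Ico (a k) (a (k + 1)))) := by
  have hIco : fairCoin (value ⁻¹' Ico (a k) (a (k + 1))) ≠ 0 :=
    fairCoin_Ico_ne_zero (ha k.lt_succ_self) (ha1 k) (h0 ▸ ha k.succ_pos)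
  have hpow (n : ℕ) : (1 / 2 ^ n : ENNReal) ≠ 0 := by simp
  refine ⟨ProbabilityTheory.cond_isProbabilityMeasure hIco, fun n => ?_, fun t => ?_⟩
  · rcases lt_or_ge k n with hkn | hnk
    · rw [jointMeasure_of_first_true ha h0 hb hk hkn .univ, inter_univ]
      exact mul_ne_zero (hpow _) hIco
    · rw [jointMeasure_of_false ha h0 (fun i hi => hb i (hi.trans_le hnk)) .univ, inter_univ]
      exact fairCoin_Ici_ne_zero (ha1 n)
  · refine tendsto_const_nhds.congr' ?_
    filter_upwards [eventually_gt_atTop k] with n hn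
    rw [jointMeasure_of_first_true ha h0 hb hk hn (measurableSet_cyl t),
      jointMeasure_of_first_true ha h0 hb hk hn .univ,
      ENNReal.mul_div_mul_left _ _ (hpow _) (by simp), inter_univ,
      ProbabilityTheory.cond_apply (measurable_value measurableSet_Ico), ENNReal.div_eq_inv_mul]

end

lemma tendsto_measure_preimage_Ici_inter {X : Type*} [MeasurableSpace X] (μ : Measure X)
    [IsFiniteMeasure μ] {f : X → ℝ} (hf : Measurable f) {a : ℕ → ℝ} {r : ℝ} (ha : Monotone a)
    (hlim : Tendsto a atTop (𝓝 r)) {T : Set X} (hT : MeasurableSet T) :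
    Tendsto (fun n => μ (f ⁻¹' Ici (a n) ∩ T)) atTop (𝓝 (μ (f ⁻¹' Ici r ∩ T))) := by
  have hinter : f ⁻¹' Ici r ∩ T = ⋂ n, f ⁻¹' Ici (a n) ∩ T := by
    ext x
    simp only [mem_inter_iff, mem_preimage, mem_Ici, mem_iInter]
    exact ⟨fun h n => ⟨(ha.ge_of_tendsto hlim n).trans h.1, h.2⟩,
      fun h => ⟨le_of_tendsto' hlim fun n => (h n).1, (h 0).2⟩⟩
  rw [hinter]
  exact tendsto_measure_iInter_atTop (fun n => ((hf measurableSet_Ici).inter hT).nullMeasurableSet)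
    (fun m n hmn => inter_subset_inter_left _ (preimage_mono (Ici_subset_Ici.2 (ha hmn))))
    ⟨0, measure_ne_top _ _⟩

lemma uniformAbove_apply (r : ℝ) (W : Set Cantor) :
    uniformAbove r W = fairCoin (value ⁻¹' Ici r ∩ W) / fairCoin (value ⁻¹' Ici r) := by
  rw [ENNReal.div_eq_inv_mul]
  exact ProbabilityTheory.cond_apply (measurable_value measurableSet_Ici) _ _

/-- The sequence with all digits zero. -/
def zeros : Cantor := fun _ => false

section

variable {a : ℕ → ℝ} {r : ℝ} (ha : StrictMono a) (h0 : a 0 = 0) (hlim : Tendsto a atTop (𝓝 r))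
  (hr : r < 1)
include ha h0 hlim hr

lemma isConditionalMeasure_zeros :
    IsConditionalMeasure (jointMeasure a) zeros (uniformAbove r) := by
  have hrne : fairCoin (value ⁻¹' Ici r) ≠ 0 := fairCoin_Ici_ne_zero hr
  have hjoint (n : ℕ) {T : Set Cantor} (hT : MeasurableSet T) :
      jointMeasure a (cyl (pre zeros n) ×ˢ T) = fairCoin (value ⁻¹' Ici (a n) ∩ T) :=
    jointMeasure_of_false ha h0 (fun _ _ => rfl) hT
  have htail {T : Set Cantor} (hT : MeasurableSet T) :=
    tendsto_measure_preimage_Ici_inter fairCoin measurable_value ha.monotone hlim hT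
  refine ⟨ProbabilityTheory.cond_isProbabilityMeasure hrne, fun n => ?_, fun t => ?_⟩
  · rw [hjoint n .univ, inter_univ]
    exact fairCoin_Ici_ne_zero ((ha.monotone.ge_of_tendsto hlim n).trans_lt hr)
  · have hmarginal : Tendsto (fun n => fairCoin (value ⁻¹' Ici (a n) ∩ univ)) atTop
        (𝓝 (fairCoin (value ⁻¹' Ici r))) := inter_univ (value ⁻¹' Ici r) ▸ htail .univ
    simp only [hjoint _ (measurableSet_cyl t), hjoint _ .univ, uniformAbove_apply]
    exact ENNReal.Tendsto.div (htail (measurableSet_cyl t)) (.inr hrne) hmarginal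
      (.inl (measure_ne_top _ _))

lemma exists_isConditionalMeasure (b : Cantor) :
    ∃ ν, IsConditionalMeasure (jointMeasure a) b ν := by
  by_cases hb : ∃ k, b k = true
  · exact ⟨_, isConditionalMeasure_of_first_true ha h0
      (fun n => (ha.monotone.ge_of_tendsto hlim n).trans_lt hr)
      (fun i hi => by simpa using Nat.find_min hb hi) (Nat.find_spec hb)⟩
  · obtain rfl : b = zeros := by simpa [funext_iff, zeros] using hb
    exact ⟨_, isConditionalMeasure_zeros ha h0 hlim hr⟩

end

lemma IsConditionalMeasure.unique {P : Measure (Cantor × Cantor)} {b : Cantor}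
    {μ ν : Measure Cantor} (hμ : IsConditionalMeasure P b μ)
    (hν : IsConditionalMeasure P b ν) : μ = ν :=
  have := hμ.1
  ext_of_cyl fun t => tendsto_nhds_unique (hμ.2.2 t) (hν.2.2 t)

/-! ### Randomness of the pair and failure of blind randomness -/

lemma primrec_pre_zeros : Primrec (pre zeros) :=
  Primrec.list_map Primrec.list_range (.const false)

lemma cyl_subset_cyl_take (t : List Bool) (j : ℕ) : cyl t ⊆ cyl (t.take j) := fun x hx i => by
  simpa using hx ⟨i, i.2.trans_le (List.length_take_le' j t)⟩

section

variable {a : ℕ → ℝ} (hac : ComputableDyadic a)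
include hac

lemma UniformlyEffectivelyOpenIn.exists_section_zeros {U : ℕ → Set (Cantor × Cantor)}
    (hU : UniformlyEffectivelyOpenIn ∅ rect U) :
    ∃ V : ℕ → Set Cantor, UniformlyEffectivelyOpenIn ∅ cyl V ∧ ∀ n x,
      (x ∈ V n → ∃ k, a k ≤ value x ∧ cyl (pre zeros k) ×ˢ {x} ⊆ U n) ∧
      ((∀ k, a k < value x) → (zeros, x) ∈ U n → x ∈ V n) := by
  obtain ⟨c, hc⟩ := hU.exists_code
  have hcode : ComputablePred fun b : (ℕ × List Bool) × (ℕ × ℕ × ℕ) =>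
      (evaln b.2.2.2 c (encode (b.1.1, (pre zeros b.2.1, b.1.2.take b.2.2.1)))).isSome := by
    have hwitness := Primrec.snd (α := ℕ × List Bool) (β := ℕ × ℕ × ℕ)
    have hzeros := primrec_pre_zeros.comp (Primrec.fst.comp hwitness)
    have htake := Primrec.list_take.comp (Primrec.fst.comp (Primrec.snd.comp hwitness))
      (Primrec.snd.comp .fst)
    have heval := Nat.Partrec.Code.primrec_evaln.comp
      (((Primrec.snd.comp (Primrec.snd.comp hwitness)).pair (.const c)).pair
        (Primrec.encode.comp ((Primrec.fst.comp .fst).pair (hzeros.pair htake))))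
    exact (Primrec.eq.comp (Primrec.option_isSome.comp heval) (.const true)).computablePred
  have habove := (hac.comp (Computable.fst.comp Computable.snd)).computablePred_le
    (computableDyadic_leftEnd.comp ((Computable.snd (α := ℕ)).comp
      (Computable.fst (β := ℕ × ℕ × ℕ))))
  refine ⟨_, uniformlyEffectivelyOpenIn_of_computablePred ∅ cyl (computablePred_and hcode habove),
    fun n x => ⟨fun hx => ?_, fun hax hx => ?_⟩⟩
  · obtain ⟨t, ⟨⟨k, j, s⟩, hs, hk⟩, hxt⟩ := mem_iUnion₂.1 hx
    refine ⟨k, hk.trans (value_mem_Icc hxt).1, ?_⟩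
    rintro ⟨y, _⟩ ⟨hy, rfl⟩
    rw [hc]
    refine mem_biUnion ⟨s, hs⟩ ⟨hy, cyl_subset_cyl_take t j hxt⟩
  · rw [hc] at hx
    obtain ⟨⟨u, t⟩, ⟨s, hs⟩, hu, ht⟩ := mem_iUnion₂.1 hx
    obtain ⟨m, hm, htm⟩ := (((tendsto_leftEnd_pre x).eventually_const_lt (hax u.length)).and
      (eventually_ge_atTop t.length)).exists
    refine mem_iUnion₂.2 ⟨pre x m, ⟨(u.length, t.length, s), ?_, hm.le⟩, self_mem_cyl_pre x m⟩
    rwa [take_pre x htm, mem_cyl_iff.1 hu, mem_cyl_iff.1 ht]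

lemma mlRandomPair_zeros (ha : StrictMono a) (h0 : a 0 = 0) {x : Cantor}
    (hax : ∀ k, a k < value x) (hx : MLRandom fairCoin x) :
    MLRandomPair (jointMeasure a) (zeros, x) := by
  rintro U ⟨hU, hμU⟩ hmem
  obtain ⟨V, hV, hVU⟩ := hU.exists_section_zeros hac
  refine hx V ⟨hV, fun n => ?_⟩
    (mem_iInter.2 fun n => (hVU n x).2 hax (mem_iInter.1 hmem n))
  calc
    fairCoin (V n) = fairCoin.prod fairCoin (V n ×ˢ univ) := by
      rw [Measure.prod_prod, measure_univ, mul_one]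
    _ ≤ fairCoin.prod fairCoin ((fun z => (locate a z, z.1)) ⁻¹' U n) := measure_mono ?_
    _ ≤ jointMeasure a (U n) := Measure.le_map_apply (measurable_locate_fst a).aemeasurable _
    _ ≤ 1 / 2 ^ n := hμU n
  rintro z ⟨hz, -⟩
  obtain ⟨k, hk, hsub⟩ := (hVU n z.1).1 hz
  exact hsub ⟨mem_cyl_pre.2 ((forall_locate_eq_false_iff ha h0).2 hk), rfl⟩

lemma not_blindRandomRel_uniformAbove {x : Cantor} (hax : ∀ k, a k ≤ value x)
    (hlim : Tendsto a atTop (𝓝 (value x))) (hx : value x < 1) (b : Cantor) :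
    ¬ BlindRandomRel b (uniformAbove (value x)) x := by
  intro hblind
  obtain ⟨c, hc⟩ := (tendsto_one_div_two_pow.eventually_lt_const (sub_pos.2 hx)).exists
  have hbelow := (computableDyadic_rightEnd.comp
    (Computable.snd.comp Computable.fst)).computablePred_le
    ((hac.comp (Computable.snd (α := ℕ × List Bool))).add
      (.one_div_two_pow (Primrec.nat_add.comp (Primrec.fst.comp .fst) (.const c)).to_comp))
  refine hblind _ ⟨uniformlyEffectivelyOpenIn_of_computablePred _ cyl hbelow, fun n => ?_⟩
    (mem_iInter.2 fun n => ?_)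
  · set W := ⋃ t ∈ {t | ∃ k, rightEnd t ≤ a k + 1 / 2 ^ (n + c)}, cyl t
    have hsub : value ⁻¹' Ici (value x) ∩ W ⊆
        value ⁻¹' Icc (value x) (value x + 1 / 2 ^ (n + c)) := by
      rintro y ⟨hy, hyW⟩
      obtain ⟨t, ⟨k, hk⟩, hyt⟩ := mem_iUnion₂.1 hyW
      exact ⟨hy, by linarith [hax k, (value_mem_Icc hyt).2]⟩
    calc
      uniformAbove (value x) W
        = fairCoin (value ⁻¹' Ici (value x) ∩ W) / fairCoin (value ⁻¹' Ici (value x)) :=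
          uniformAbove_apply _ _
      _ ≤ volume (Icc (value x) (value x + 1 / 2 ^ (n + c))) / ENNReal.ofReal (1 / 2 ^ c) := by
        gcongr
        · exact (measure_mono hsub).trans (fairCoin_value_preimage_le measurableSet_Icc)
        · rw [fairCoin_Ici (value_nonneg x)]
          exact ENNReal.ofReal_le_ofReal hc.le
      _ = 1 / 2 ^ n := by
        rw [Real.volume_Icc, add_sub_cancel_left, ← ENNReal.ofReal_div_of_pos (by positivity),
          ← ofReal_one_div_two_pow, pow_add]
        congr 1
        field
  · have hright : Tendsto (fun m => rightEnd (pre x m)) atTop (𝓝 (value x)) := by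
      simpa only [rightEnd_eq, length_pre, add_zero] using
        (tendsto_leftEnd_pre x).add tendsto_one_div_two_pow
    obtain ⟨m, hm⟩ := (hright.eventually_lt
      (hlim.add_const (1 / 2 ^ (n + c))) (lt_add_of_pos_right _ (by positivity))).exists
    exact mem_biUnion ⟨m, hm.le⟩ (self_mem_cyl_pre x m)

end

end CantorRandom

theorem mainTheorem4 :
    (∃ w : Cantor, IsOmegaNumber w) ∧
    ∀ α₂ : Cantor, IsOmegaNumber α₂ →
      ∃ (P : Measure (Cantor × Cantor)) (cond : Cantor → Measure Cantor),
        IsProbabilityMeasure P ∧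
        ComputableMeasure P ∧
        (∀ a : Cantor, IsConditionalMeasure P a (cond a)) ∧
        ∃ α₁ : Cantor,
          MLRandomPair P (α₁, α₂) ∧
          cond α₁ = uniformAbove (value α₂) ∧
          ¬ BlindRandomRel α₁ (cond α₁) α₂ := by
  refine ⟨exists_isOmegaNumber, fun x ⟨hlower, hrandom⟩ => ?_⟩
  obtain ⟨a, hac, h0, ha, hlim⟩ := hlower.exists_strictMono hrandom.value_pos
  have hlt (k : ℕ) : a k < value x :=
    (ha k.lt_succ_self).trans_le (ha.monotone.ge_of_tendsto hlim (k + 1))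
  have hx1 : value x < 1 := hrandom.value_lt_one
  choose cond hcond using exists_isConditionalMeasure ha h0 hlim hx1
  have hzeros : cond zeros = uniformAbove (value x) :=
    (hcond zeros).unique (isConditionalMeasure_zeros ha h0 hlim hx1)
  refine ⟨jointMeasure a, cond, inferInstance, computableMeasure_jointMeasure ha h0 hac, hcond,
    zeros, mlRandomPair_zeros hac ha h0 hlt hrandom, hzeros, ?_⟩
  rw [hzeros]
  exact not_blindRandomRel_uniformAbove hac (fun k => (hlt k).le) hlim hx1 zeros
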